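/- Let $K$ be a field and let $a,b,s$ be positive integers with $(b-1)s+1<a\le bs$. In the polynomial ring $T=K[z_1,\dots,z_s]$ (with the standard grading) let $$I=I_a(z_1^b\cdots z_s^b)=\bigl\langle z_1^{n_1}\cdots z_s^{n_s} : 0\le n_i\le b \text{ for all } i,\ n_1+\cdots+n_s=a\bigr\rangle .$$ Put $\delta=a-(b-1)s-1$, $c_0=s-\lfloor (a-1)/b\rfloor$ and $\mu_a^0=a-b(s-c_0)$. For $m\ge 1$ let $I^{(m)}=\bigcap_{\mathfrak p\in\operatorname{Ass}(T/I)}(I^mT_{\mathfrak p}\cap T)$ be the $m$-th symbolic power of $I$ (the intersection is over all associated primes of $T/I$). For a nonzero homogeneous ideal $J$ let $\alpha(J)$ be the least degree of a nonzero form in $J$. Let $\widehat\alpha(I)=\lim_{m\to\infty}\alpha(I^{(m)})/m$ be the Waldschmidt constant of $I$, and let $$\rho(I)=\sup\Bigl\{\tfrac{m}{r} : m,r\ge 1,\ I^{(m)}\not\subseteq I^r\Bigr\}$$ be its resurgence. Then this limit exists and is positive, the set in the definition of $\rho(I)$ is nonempty and bounded above, and $$\rho(I)=\frac{\alpha(I)}{\widehat\alpha(I)}=\frac{a(s-\delta)}{s\bigl(\mu_a^0+b(s-\delta-c_0)\bigr)}.$$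 -/

import Mathlib

namespace FoldProduct

/-- The `a`-fold product ideal `I_a(f_1^{m_1} ⋯ f_s^{m_s})`: it is generated by the products
`f_1^{n_1} ⋯ f_s^{n_s}` with `0 ≤ n_i ≤ m_i` and `n_1 + ⋯ + n_s = a`. -/
def foldProductIdeal {R : Type*} [CommRing R] {s : ℕ} (a : ℕ) (f : Fin s → R) (m : Fin s → ℕ) :
    Ideal R :=
  Ideal.span {g : R | ∃ n : Fin s → ℕ, (∀ i, n i ≤ m i) ∧ ∑ i, n i = a ∧ g = ∏ i, f i ^ n i}

/-- The `m`-th symbolic power `I^(m)`: the intersection of `I^m R_p ∩ R` over all associated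
primes `p` of `R / I`. -/
noncomputable def symbolicPower {R : Type*} [CommRing R] (I : Ideal R) (m : ℕ) : Ideal R :=
  ⨅ p : associatedPrimes R (R ⧸ I),
    ((I ^ m).map (algebraMap R (Localization.AtPrime p.1))).comap
      (algebraMap R (Localization.AtPrime p.1))

/-- The set of the ratios `m / r` of positive integers such that `I^(m)` is not contained
in `I^r`. -/
def noncontainmentRatios {R : Type*} [CommRing R] (I : Ideal R) : Set ℝ :=
  {x : ℝ | ∃ m r : ℕ, 0 < m ∧ 0 < r ∧ ¬ symbolicPower I m ≤ I ^ r ∧ x = (m : ℝ) / (r : ℝ)}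

/-- The resurgence `ρ(I)`, the supremum of `noncontainmentRatios I`. -/
noncomputable def resurgence {R : Type*} [CommRing R] (I : Ideal R) : ℝ :=
  sSup (noncontainmentRatios I)

/-- `α(I)`, the least degree of a nonzero form in the (nonzero homogeneous) ideal `I`. -/
noncomputable def initialDegree {K σ : Type*} [Field K] (I : Ideal (MvPolynomial σ K)) : ℕ :=
  sInf {d : ℕ | ∃ f ∈ I, f ≠ 0 ∧ f.IsHomogeneous d}

/-- The Waldschmidt constant, the limit of `α(I^(m)) / m` as `m` tends to infinity. -/
noncomputable def waldschmidtConstant {K σ : Type*} [Field K]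
    (I : Ideal (MvPolynomial σ K)) : ℝ :=
  Filter.limUnder Filter.atTop (fun m : ℕ => (initialDegree (symbolicPower I m) : ℝ) / (m : ℝ))

end FoldProduct

/-! Everything reduces to inequalities on exponent vectors `u`. Put t = s - δ, so a + t = bs + 1,
and L = (b - 1)t + 1. The monomials of I^r are given by r a ≤ ∑_A u + r b |Aᶜ| for every set A of
variables. Localizing at the associated primes keeps, for I^(m), only the sets with |A| ≤ t
(`mem_symbolicPower_veroneseIdeal_iff`). For |A| = t the condition reads ∑_A u ≥ mL. Averaging over
such A gives degree at least s m L / t, and constant vectors nearly attain it, so the Waldschmidt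
constant is sL/t. The same averaging recovers the conditions for |A| > t once m/r ≥ at/(sL), giving
I^(m) ⊆ I^r; constant vectors give noncontainments with ratios tending to at/(sL). -/

namespace FoldProduct

open Finset MvPolynomial

/-! ### Combinatorics of truncated sums -/

section Combinatorics

variable {σ : Type*} [Fintype σ]

theorem exists_between_sum_eq {l h : σ → ℕ} (hlh : l ≤ h) {a : ℕ} (hl : ∑ i, l i ≤ a)
    (hh : a ≤ ∑ i, h i) : ∃ n : σ → ℕ, l ≤ n ∧ n ≤ h ∧ ∑ i, n i = a := by
  classical
  induction a, hl using Nat.le_induction with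
  | base => exact ⟨l, le_rfl, hlh, rfl⟩
  | succ a _ ih =>
    obtain ⟨n, h1, h2, h3⟩ := ih (by omega)
    obtain ⟨j, -, hj⟩ := Finset.exists_lt_of_sum_lt (s := univ) (f := n) (g := h) (by omega)
    refine ⟨n + Pi.single j 1, h1.trans (by simp), fun i => ?_, ?_⟩
    · rcases eq_or_ne i j with rfl | hij
      · simpa using hj
      · simpa [hij] using h2 i
    · simp [Finset.sum_add_distrib, h3]

/-- The right-hand side is smallest at A = {i : u i < c}, where it equals the truncated sum. -/
theorem le_sum_min_iff [DecidableEq σ] (u : σ → ℕ) (N c : ℕ) :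
    N ≤ ∑ i, min (u i) c ↔ ∀ A : Finset σ, N ≤ ∑ i ∈ A, u i + c * #Aᶜ := by
  have key (A : Finset σ) : ∑ i, min (u i) c = ∑ i ∈ A, min (u i) c + ∑ i ∈ Aᶜ, min (u i) c :=
    (Finset.sum_add_sum_compl A _).symm
  constructor
  · intro h A
    refine h.trans ?_
    rw [key A]
    refine add_le_add (Finset.sum_le_sum fun i _ => min_le_left _ _) ?_
    refine (Finset.sum_le_card_nsmul _ _ c fun i _ => min_le_right _ _).trans ?_
    simp [mul_comm]
  · intro h
    refine (h (univ.filter fun i => u i < c)).trans ?_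
    rw [key (univ.filter fun i => u i < c)]
    refine add_le_add (Finset.sum_le_sum fun i hi => ?_) ?_
    · simp only [Finset.mem_filter] at hi
      exact le_min le_rfl hi.2.le
    · rw [mul_comm, ← smul_eq_mul]
      refine Finset.card_nsmul_le_sum _ _ c fun i hi => ?_
      simp only [Finset.mem_compl, Finset.mem_filter, Finset.mem_univ, true_and, not_lt] at hi
      exact le_min hi le_rfl

/-- Integer decomposition: an exponent vector of the `(m + 1)`-st power dominates
a generator of the ideal whose complement lies in the `m`-th power. -/
theorem exists_generator_le {a b m : ℕ} {u : σ → ℕ}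
    (hu : (m + 1) * a ≤ ∑ i, min (u i) ((m + 1) * b)) :
    ∃ n : σ → ℕ, (∀ i, n i ≤ b) ∧ n ≤ u ∧ ∑ i, n i = a ∧
      m * a ≤ ∑ i, min (u i - n i) (m * b) := by
  obtain ⟨v, -, hv, hva⟩ := exists_between_sum_eq (l := 0)
    (h := fun i => min (u i) ((m + 1) * b)) (fun i => Nat.zero_le _) (by simp) hu
  have hvu (i : σ) : v i ≤ u i := (hv i).trans (min_le_left _ _)
  have hvb (i : σ) : v i ≤ m * b + b := (hv i).trans ((min_le_right _ _).trans (by ring_nf; rfl))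
  -- The lower bound keeps v - n below m b. As v ≤ (m + 1) b, the sum of v / (m + 1), which is a,
  -- lies between the sums of the two bounds.
  obtain ⟨n, hn1, hn2, hna⟩ := exists_between_sum_eq (l := fun i => v i - m * b)
    (h := fun i => min b (v i)) (a := a)
    (fun i => le_min (by have := hvb i; simp only; omega) (Nat.sub_le _ _))
    (by
      refine Nat.le_of_mul_le_mul_left (c := m + 1) ?_ (Nat.succ_pos _)
      rw [← hva, Finset.mul_sum]
      refine Finset.sum_le_sum fun i _ => ?_
      have h1 := hvb i
      rcases le_total (v i) (m * b) with h | h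
      · simp [Nat.sub_eq_zero_of_le h]
      · obtain ⟨d, hd⟩ := Nat.exists_eq_add_of_le h
        have hd' : d ≤ b := by omega
        have := Nat.mul_le_mul_left m hd'
        rw [hd, Nat.add_sub_cancel_left]
        linarith)
    (by
      refine Nat.le_of_mul_le_mul_left (c := m + 1) ?_ (Nat.succ_pos _)
      rw [← hva, Finset.mul_sum]
      refine Finset.sum_le_sum fun i _ => ?_
      have h1 := hvb i
      rcases le_total b (v i) with h | h
      · rw [min_eq_left h]; linarith
      · rw [min_eq_right h]; nlinarith [Nat.zero_le (m * v i)])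
  refine ⟨n, fun i => (hn2 i).trans (min_le_left _ _),
    fun i => (hn2 i).trans ((min_le_right _ _).trans (hvu i)), hna, ?_⟩
  have hsum : ∑ i, (v i - n i) = m * a := by
    have : ∑ i, (v i - n i) + ∑ i, n i = ∑ i, v i := by
      rw [← Finset.sum_add_distrib]
      exact Finset.sum_congr rfl fun i _ => Nat.sub_add_cancel ((hn2 i).trans (min_le_right _ _))
    have h2 : (m + 1) * a = m * a + a := by ring
    omega
  rw [← hsum]
  refine Finset.sum_le_sum fun i _ => le_min (Nat.sub_le_sub_right (hvu i) _) ?_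
  have := hn1 i
  simp only at this
  omega

end Combinatorics

/-- If all subsets of size `t` have sum at least `L`, then larger subsets have, on average,
the same sum per element. -/
theorem card_mul_le_mul_sum {σ : Type*} [DecidableEq σ] {u : σ → ℕ} {t L : ℕ} (ht : 0 < t)
    (h : ∀ A : Finset σ, #A = t → L ≤ ∑ i ∈ A, u i) (A : Finset σ) (hA : t ≤ #A) :
    #A * L ≤ t * ∑ i ∈ A, u i := by
  induction hAk : #A generalizing A with
  | zero => omega
  | succ k ih =>
    rcases hA.eq_or_lt with hA' | hA'
    · rw [← hAk, ← hA']
      exact Nat.mul_le_mul_left _ (h A hA'.symm)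
    have hk : 0 < k := by omega
    have h1 : ∀ i ∈ A, k * L ≤ t * ∑ j ∈ A.erase i, u j := fun i hi => by
      have hc : #(A.erase i) = k := by rw [Finset.card_erase_of_mem hi]; omega
      exact ih _ (by omega) hc
    -- Double counting: each element survives in k of the k + 1 deletions.
    have h2 : ∑ i ∈ A, ∑ j ∈ A.erase i, u j = k * ∑ i ∈ A, u i := by
      have h3 : ∑ i ∈ A, ∑ j ∈ A.erase i, u j + ∑ i ∈ A, u i = (k + 1) * ∑ i ∈ A, u i := by
        rw [← Finset.sum_add_distrib, Finset.sum_congr rfl fun i hi => Finset.sum_erase_add A u hi]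
        simp [*]
      linarith
    have h4 := Finset.card_nsmul_le_sum A _ _ h1
    rw [← Finset.mul_sum, h2, smul_eq_mul, hAk] at h4
    refine Nat.le_of_mul_le_mul_left (c := k) ?_ hk
    linarith

/-! ### Monomials in ordinary powers -/

section Powers

variable {K : Type*} [Field K] {s : ℕ}

/-- The exponents of the monomials in the `m`-th power of the ideal. -/
def powerExponents (s a b m : ℕ) : Set (Fin s →₀ ℕ) :=
  {u | m * a ≤ ∑ i, min (u i) (m * b)}

theorem powerExponents_of_le {a b m : ℕ} {u v : Fin s →₀ ℕ} (hu : u ∈ powerExponents s a b m)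
    (huv : u ≤ v) : v ∈ powerExponents s a b m :=
  le_trans (show m * a ≤ _ from hu)
    (Finset.sum_le_sum fun i _ => min_le_min (huv i) le_rfl)

theorem foldProductIdeal_eq_span (a b : ℕ) :
    foldProductIdeal a (fun i : Fin s => (X i : MvPolynomial (Fin s) K)) (fun _ => b) =
      Ideal.span ((fun u => monomial u (1 : K)) '' powerExponents s a b 1) := by
  apply le_antisymm
  · refine Ideal.span_le.2 ?_
    rintro _ ⟨n, hn, hna, rfl⟩
    refine Ideal.subset_span ⟨Finsupp.equivFunOnFinite.symm n, ?_, ?_⟩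
    · simp only [powerExponents, Set.mem_ofPred_eq, one_mul, Finsupp.coe_equivFunOnFinite_symm]
      rw [← hna]
      exact Finset.sum_le_sum fun i _ => le_min le_rfl (hn i)
    · simp [monomial_eq, Finsupp.prod_fintype]
  · refine Ideal.span_le.2 ?_
    rintro _ ⟨u, hu, rfl⟩
    obtain ⟨n, hn, hnu, hna, -⟩ := exists_generator_le (m := 0) (u := u) (a := a) (b := b)
      (by simpa [powerExponents] using hu)
    have hdvd : (∏ i, (X i : MvPolynomial (Fin s) K) ^ n i) ∣ monomial u (1 : K) := by
      rw [monomial_eq, Finsupp.prod_fintype _ _ (by simp), C_1, one_mul]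
      exact Finset.prod_dvd_prod_of_dvd _ _ fun i _ => pow_dvd_pow _ (hnu i)
    exact Ideal.mem_of_dvd _ hdvd (Ideal.subset_span ⟨n, hn, hna, rfl⟩)

theorem foldProductIdeal_pow_eq_span (a b m : ℕ) :
    foldProductIdeal a (fun i : Fin s => (X i : MvPolynomial (Fin s) K)) (fun _ => b) ^ m =
      Ideal.span ((fun u => monomial u (1 : K)) '' powerExponents s a b m) := by
  induction m with
  | zero =>
    rw [pow_zero, Ideal.one_eq_top, eq_comm, Ideal.eq_top_iff_one]
    exact Ideal.subset_span ⟨0, by simp [powerExponents], rfl⟩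
  | succ m ih =>
    rw [pow_succ, ih, foldProductIdeal_eq_span, Ideal.span_mul_span']
    apply le_antisymm
    · refine Ideal.span_mono ?_
      rintro _ ⟨_, ⟨u, hu, rfl⟩, _, ⟨v, hv, rfl⟩, rfl⟩
      refine ⟨u + v, ?_, by simp [monomial_mul]⟩
      simp only [powerExponents, Set.mem_ofPred_eq, one_mul] at hu hv ⊢
      calc (m + 1) * a = m * a + a := by ring
        _ ≤ ∑ i, (min (u i) (m * b) + min (v i) b) := by
          rw [Finset.sum_add_distrib]; exact add_le_add hu hv
        _ ≤ _ := Finset.sum_le_sum fun i _ => by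
          rw [add_mul, one_mul, Finsupp.add_apply]; omega
    · refine Ideal.span_mono ?_
      rintro _ ⟨u, hu, rfl⟩
      obtain ⟨n, hn, hnu, hna, hm⟩ := exists_generator_le hu
      refine ⟨_, ⟨u - Finsupp.equivFunOnFinite.symm n, ?_, rfl⟩, _,
        ⟨Finsupp.equivFunOnFinite.symm n, ?_, rfl⟩, ?_⟩
      · simpa [powerExponents] using hm
      · simp only [powerExponents, Set.mem_ofPred_eq, one_mul, Finsupp.coe_equivFunOnFinite_symm]
        rw [← hna]
        exact Finset.sum_le_sum fun i _ => le_min le_rfl (hn i)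
      · have : u - Finsupp.equivFunOnFinite.symm n + Finsupp.equivFunOnFinite.symm n = u :=
          tsub_add_cancel_of_le fun i => hnu i
        simp [monomial_mul, this]

theorem mem_foldProductIdeal_pow_iff {a b m : ℕ} {f : MvPolynomial (Fin s) K} :
    f ∈ foldProductIdeal a (fun i : Fin s => (X i : MvPolynomial (Fin s) K)) (fun _ => b) ^ m ↔
      ∀ u ∈ f.support, u ∈ powerExponents s a b m := by
  rw [foldProductIdeal_pow_eq_span, mem_ideal_span_monomial_image]
  exact forall₂_congr fun u _ =>
    ⟨fun ⟨v, hv, hvu⟩ => powerExponents_of_le hv hvu, fun hu => ⟨u, hu, le_rfl⟩⟩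

end Powers

end FoldProduct

/-! ### Associated primes and symbolic powers -/

namespace FoldProduct

open Finset MvPolynomial

theorem mem_symbolicPower_iff {R : Type*} [CommRing R] {I : Ideal R} {m : ℕ} {f : R} :
    f ∈ symbolicPower I m ↔
      ∀ p ∈ associatedPrimes R (R ⧸ I), ∃ g ∉ p, g * f ∈ I ^ m := by
  simp only [symbolicPower, Submodule.mem_iInf, Ideal.mem_comap, Subtype.forall]
  refine forall₂_congr fun p hp => ?_
  have : p.IsPrime := hp.1
  rw [IsLocalization.algebraMap_mem_map_algebraMap_iff p.primeCompl]
  rfl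

theorem mem_associatedPrimes_quotient_iff {R : Type*} [CommRing R] [IsNoetherianRing R]
    {I p : Ideal R} :
    p ∈ associatedPrimes R (R ⧸ I) ↔ p.IsPrime ∧ ∃ f, ∀ g, g ∈ p ↔ g * f ∈ I := by
  rw [AssociatedPrimes.mem_iff, isAssociatedPrime_iff]
  refine and_congr_right fun _ => ?_
  rw [(Ideal.Quotient.mk_surjective (I := I)).exists]
  refine exists_congr fun f => ?_
  rw [SetLike.ext_iff]
  refine forall_congr' fun g => iff_congr Iff.rfl ?_
  rw [Submodule.mem_colon_singleton, Submodule.mem_bot, ← Ideal.Quotient.eq_zero_iff_mem,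
    map_mul]
  rfl

section Order

variable {σ K : Type*} [Field K]

/-- The order of vanishing of a polynomial along the coordinate subspace
where the variables in `A` are zero. -/
noncomputable def orderAlong (A : Finset σ) (f : MvPolynomial σ K) : ℕ∞ :=
  MvPowerSeries.weightedOrder ((A : Set σ).indicator 1) (f : MvPowerSeries σ K)

theorem weight_indicator (A : Finset σ) (u : σ →₀ ℕ) :
    Finsupp.weight ((A : Set σ).indicator (1 : σ → ℕ)) u = ∑ i ∈ A, u i := by
  classical
  rw [Finsupp.weight_apply, Finsupp.sum, Finset.sum_subset (s₂ := u.support ∪ A)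
    Finset.subset_union_left (fun i _ hi => by simp [Finsupp.notMem_support_iff.1 hi]), eq_comm]
  rw [Finset.sum_subset (Finset.subset_union_right (s₁ := u.support)) (f := fun i =>
    u i • (A : Set σ).indicator (1 : σ → ℕ) i)
    (fun i _ hi => by simp [hi]) |>.symm]
  exact Finset.sum_congr rfl fun i hi => by simp [hi]

theorem le_orderAlong_iff {A : Finset σ} {f : MvPolynomial σ K} {n : ℕ} :
    (n : ℕ∞) ≤ orderAlong A f ↔ ∀ u ∈ f.support, n ≤ ∑ i ∈ A, u i := by
  constructor
  · intro h u hu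
    have := h.trans (MvPowerSeries.weightedOrder_le _ (d := u)
      (by rwa [coeff_coe, ← mem_support_iff]))
    rw [weight_indicator] at this
    exact_mod_cast this
  · intro h
    refine MvPowerSeries.nat_le_weightedOrder _ fun u hu => ?_
    rw [weight_indicator] at hu
    rw [coeff_coe]
    by_contra h0
    exact absurd (h u (mem_support_iff.2 h0)) (by omega)

/-- Additivity makes the coordinate ideals prime and lets a factor of order zero be cancelled. -/
theorem orderAlong_mul (A : Finset σ) (f g : MvPolynomial σ K) :
    orderAlong A (f * g) = orderAlong A f + orderAlong A g := by
  rw [orderAlong, MvPolynomial.coe_mul, MvPowerSeries.weightedOrder_mul]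
  rfl

theorem mem_span_X_iff {A : Finset σ} {f : MvPolynomial σ K} :
    f ∈ Ideal.span (X '' (A : Set σ) : Set (MvPolynomial σ K)) ↔ orderAlong A f ≠ 0 := by
  rw [mem_ideal_span_X_image, ← Order.one_le_iff_ne_zero, ← Nat.cast_one, le_orderAlong_iff]
  refine forall₂_congr fun u _ => ?_
  rw [Nat.one_le_iff_ne_zero, Ne, Finset.sum_eq_zero_iff]
  push Not
  rfl

theorem isPrime_span_X (A : Finset σ) :
    (Ideal.span (X '' (A : Set σ) : Set (MvPolynomial σ K))).IsPrime := by
  refine ⟨?_, fun {f g} h => ?_⟩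
  · rw [Ideal.ne_top_iff_one, mem_span_X_iff, not_not, orderAlong, MvPolynomial.coe_one,
      MvPowerSeries.weightedOrder_one]
  · rw [mem_span_X_iff, orderAlong_mul] at h
    rw [mem_span_X_iff, mem_span_X_iff]
    by_contra! h'
    exact h (by simp [h'.1, h'.2])

theorem forall_mem_support_mul_monomial {f : MvPolynomial σ K} {v : σ →₀ ℕ}
    {P : (σ →₀ ℕ) → Prop} :
    (∀ u ∈ (f * monomial v (1 : K)).support, P u) ↔ ∀ u ∈ f.support, P (u + v) := by
  constructor
  · intro h u hu
    refine h _ ?_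
    rw [mem_support_iff, coeff_mul_monomial, mul_one]
    exact mem_support_iff.1 hu
  · intro h u hu
    rw [mem_support_iff, coeff_mul_monomial', mul_one, ite_ne_right_iff] at hu
    have := h _ (mem_support_iff.2 hu.2)
    rwa [tsub_add_cancel_of_le hu.1] at this

end Order

section Symbolic

variable {K : Type*} [Field K] {s : ℕ}

variable (K s) in
/-- The ideal of Veronese type generated by the monomials of degree `a`
with exponents at most `b`. -/
noncomputable abbrev veroneseIdeal (a b : ℕ) : Ideal (MvPolynomial (Fin s) K) :=
  foldProductIdeal a (fun i : Fin s => X i) (fun _ => b)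

theorem mem_veroneseIdeal_iff {a b : ℕ} {f : MvPolynomial (Fin s) K} :
    f ∈ veroneseIdeal K s a b ↔ ∀ u ∈ f.support, a ≤ ∑ i, min (u i) b := by
  have := mem_foldProductIdeal_pow_iff (a := a) (b := b) (m := 1) (f := f)
  simpa [powerExponents] using this

/-- The exponents of the monomials in the `m`-th symbolic power of the ideal. -/
def symbolicExponents (s a b t m : ℕ) : Set (Fin s →₀ ℕ) :=
  {u | ∀ A : Finset (Fin s), #A ≤ t → m * a ≤ ∑ i ∈ A, u i + m * b * #Aᶜ}

theorem span_X_mem_associatedPrimes {a b t : ℕ} (hb : 0 < b) (hat : a + t = b * s + 1)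
    {S : Finset (Fin s)} (hS : #S = t) :
    Ideal.span (X '' (S : Set (Fin s)) : Set (MvPolynomial (Fin s) K)) ∈
      associatedPrimes _ (MvPolynomial (Fin s) K ⧸ veroneseIdeal K s a b) := by
  rw [mem_associatedPrimes_quotient_iff]
  -- This monomial has degree bs - t = a - 1. Only variables in S can still raise its truncated
  -- degree, so its colon ideal is generated by S.
  let w : Fin s →₀ ℕ := Finsupp.equivFunOnFinite.symm fun i => if i ∈ S then b - 1 else b
  have hw : ∑ i, w i + 1 = a := by
    have : ∑ i, w i + ∑ i ∈ S, 1 = b * s := by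
      rw [← Finset.sum_add_sum_compl S, add_right_comm, ← Finset.sum_add_distrib,
        Finset.sum_congr rfl (g := fun _ => b) fun i hi => by simp [w, hi]; omega,
        Finset.sum_congr (s₁ := Sᶜ) rfl (g := fun _ => b) fun i hi => by
          simp [w, Finset.mem_compl.1 hi],
        Finset.sum_add_sum_compl S]
      simp [mul_comm]
    simp only [sum_const, hS, smul_eq_mul, mul_one] at this
    omega
  refine ⟨isPrime_span_X S, monomial w 1, fun g => ?_⟩
  rw [mem_ideal_span_X_image, mem_veroneseIdeal_iff, forall_mem_support_mul_monomial]
  refine forall₂_congr fun v _ => ?_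
  have hmin (i : Fin s) : w i ≤ min ((v + w) i) b := by
    by_cases hi : i ∈ S <;> simp [w, hi]
  constructor
  · rintro ⟨i, hi, hvi⟩
    rw [← hw]
    refine Finset.sum_lt_sum (fun j _ => hmin j) ⟨i, Finset.mem_univ _, ?_⟩
    have hi' : i ∈ S := hi
    simp only [Finsupp.add_apply, w, Finsupp.coe_equivFunOnFinite_symm, hi', if_true]
    omega
  · intro h
    by_contra! h0
    have : ∑ i, min ((v + w) i) b = ∑ i, w i := Finset.sum_congr rfl fun i _ => by
      by_cases hi : i ∈ S
      · simp [w, hi, h0 i hi]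
      · simp [w, hi]
    omega

/-- Write p = (I : f) and pick a monomial `u` of f outside I. Each variable of S pushes `u` into I,
so, if S is nonempty, the truncated degree of `u` is a - 1 and u i < b on S. Hence a - 1 + |S| ≤ bs.
-/
theorem card_X_mem_associatedPrime_le {a b t : ℕ} (hat : a + t = b * s + 1)
    {p : Ideal (MvPolynomial (Fin s) K)}
    (hp : p ∈ associatedPrimes _ (MvPolynomial (Fin s) K ⧸ veroneseIdeal K s a b))
    {S : Finset (Fin s)} (hS : ∀ i ∈ S, X i ∈ p) : #S ≤ t := by
  rw [mem_associatedPrimes_quotient_iff] at hp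
  obtain ⟨hprime, f, hf⟩ := hp
  have hfI : f ∉ veroneseIdeal K s a b := fun h =>
    hprime.ne_top ((Ideal.eq_top_iff_one p).2 ((hf 1).2 (by rwa [one_mul])))
  rw [mem_veroneseIdeal_iff] at hfI
  push Not at hfI
  obtain ⟨u, hu, hua⟩ := hfI
  have hui : ∀ i ∈ S, a ≤ ∑ j, min (u j + Finsupp.single i 1 j) b := fun i hi => by
    have h := (hf _).1 (hS i hi)
    rw [mul_comm, X, mem_veroneseIdeal_iff, forall_mem_support_mul_monomial] at h
    exact h u hu
  rcases S.eq_empty_or_nonempty with rfl | ⟨i₀, hi₀⟩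
  · simp
  have h1 : a ≤ ∑ j, min (u j) b + 1 := by
    refine (hui i₀ hi₀).trans ?_
    calc _ ≤ ∑ j, (min (u j) b + Finsupp.single i₀ 1 j) :=
          Finset.sum_le_sum fun j _ => by omega
      _ = _ := by rw [Finset.sum_add_distrib]; simp [Finsupp.single_apply]
  have h2 : ∀ i ∈ S, u i < b := fun i hi => by
    by_contra! hb
    refine absurd ((hui i hi).trans (Finset.sum_le_sum fun j _ => ?_)) hua.not_ge
    rcases eq_or_ne i j with rfl | hij
    · simp [hb]
    · simp [Finsupp.single_eq_of_ne hij.symm]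
  have h3 : ∑ j, min (u j) b + ∑ j, (if j ∈ S then 1 else 0) ≤ b * s := by
    rw [← Finset.sum_add_distrib]
    refine (Finset.sum_le_card_nsmul _ _ b fun j _ => ?_).trans (by simp [mul_comm])
    split_ifs with hj
    · have := h2 j hj; omega
    · simp
  simp at h3
  omega

theorem mem_symbolicPower_veroneseIdeal_iff {a b t m : ℕ} (hb : 0 < b)
    (hat : a + t = b * s + 1) (hts : t ≤ s) {f : MvPolynomial (Fin s) K} :
    f ∈ symbolicPower (veroneseIdeal K s a b) m ↔
      ∀ u ∈ f.support, u ∈ symbolicExponents s a b t m := by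
  rw [mem_symbolicPower_iff]
  constructor
  · intro h u hu A hA
    -- A multiplier outside the prime of S ⊇ A has order zero along A, so f inherits the order bound
    -- of g f.
    obtain ⟨S, hAS, hS⟩ := Finset.exists_superset_card_eq hA (by simpa using hts)
    obtain ⟨g, hg, hgf⟩ := h _ (span_X_mem_associatedPrimes hb hat hS)
    have hgA : orderAlong A g = 0 := by
      by_contra h0
      rw [← ne_eq, ← mem_span_X_iff] at h0
      exact hg (Ideal.span_mono (Set.image_mono (by exact_mod_cast hAS)) h0)
    have hord : ((m * a - m * b * #Aᶜ : ℕ) : ℕ∞) ≤ orderAlong A (g * f) := by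
      rw [le_orderAlong_iff]
      intro v hv
      have := (le_sum_min_iff _ _ _).1 (mem_foldProductIdeal_pow_iff.1 hgf v hv) A
      omega
    rw [orderAlong_mul, hgA, zero_add, le_orderAlong_iff] at hord
    have := hord u hu
    omega
  · intro h p hp
    have hprime : p.IsPrime := hp.1
    classical
    let S : Finset (Fin s) := univ.filter fun i => X i ∈ p
    have hSt : #S ≤ t :=
      card_X_mem_associatedPrime_le hat hp fun i hi => (Finset.mem_filter.1 hi).2
    -- This monomial avoids p, and its exponents m b reduce the condition for A to the one for A ∩
    -- S.
    let w : Fin s →₀ ℕ := Finsupp.equivFunOnFinite.symm fun i => if i ∈ S then 0 else m * b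
    refine ⟨monomial w 1, ?_, ?_⟩
    · rw [monomial_eq, Finsupp.prod_fintype _ _ (by simp), C_1, one_mul]
      intro hmem
      obtain ⟨i, -, hi⟩ := hprime.prod_mem_iff.1 hmem
      by_cases hiS : i ∈ S
      · simp [w, hiS] at hi
        exact hprime.ne_top ((Ideal.eq_top_iff_one p).2 hi)
      · exact hiS (Finset.mem_filter.2 ⟨Finset.mem_univ _, hprime.mem_of_pow_mem _ hi⟩)
    · rw [mul_comm, mem_foldProductIdeal_pow_iff, forall_mem_support_mul_monomial]
      intro u hu
      refine (le_sum_min_iff _ _ _).2 fun A => ?_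
      refine (h u hu (A ∩ S) ((Finset.card_le_card Finset.inter_subset_right).trans hSt)).trans ?_
      have h1 : #(A ∩ S)ᶜ = #Aᶜ + #(A \ S) := by
        have := Finset.card_inter_add_card_sdiff A S
        have h2 := Finset.card_le_univ A
        rw [Finset.card_compl, Finset.card_compl]
        omega
      have h2 : ∑ i ∈ A ∩ S, u i + #(A \ S) * (m * b) ≤ ∑ i ∈ A, (u + w) i := by
        rw [← Finset.sum_inter_add_sum_sdiff A S]
        refine add_le_add (Finset.sum_le_sum fun i _ => by simp) ?_
        rw [← smul_eq_mul]
        refine Finset.card_nsmul_le_sum _ _ _ fun i hi => ?_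
        simp [w, (Finset.mem_sdiff.1 hi).2]
      rw [h1]
      linarith

end Symbolic

end FoldProduct

/-! ### Comparing the two systems of inequalities -/

namespace FoldProduct

open Finset MvPolynomial

section Exponents

variable {s a b t L : ℕ}

theorem le_sum_of_card_eq (hat : a + t = b * s + 1) (hL : L + t = b * t + 1) {m : ℕ}
    {u : Fin s →₀ ℕ} (hu : u ∈ symbolicExponents s a b t m) (A : Finset (Fin s)) (hA : #A = t) :
    m * L ≤ ∑ i ∈ A, u i := by
  have h := hu A hA.le
  have hc := Finset.card_add_card_compl A
  rw [hA, Fintype.card_fin] at hc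
  generalize #Aᶜ = d at *
  have haL : a = L + b * d := by subst hc; linarith
  rw [haL] at h
  linarith

theorem mul_le_mul_degree (ht : 0 < t) (hts : t ≤ s) (hat : a + t = b * s + 1)
    (hL : L + t = b * t + 1) {m : ℕ} {u : Fin s →₀ ℕ} (hu : u ∈ symbolicExponents s a b t m) :
    s * (m * L) ≤ t * ∑ i, u i := by
  simpa using card_mul_le_mul_sum ht (le_sum_of_card_eq hat hL hu) univ (by simpa using hts)

theorem mem_powerExponents_of_mem_symbolicExponents (hb : 0 < b) (ht : 0 < t) (hts : t ≤ s)
    (hat : a + t = b * s + 1) (hL : L + t = b * t + 1) {m r : ℕ}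
    (hmr : r * (a * t) ≤ m * (s * L)) {u : Fin s →₀ ℕ} (hu : u ∈ symbolicExponents s a b t m) :
    u ∈ powerExponents s a b r := by
  refine (le_sum_min_iff _ _ _).2 fun A => ?_
  have hc := Finset.card_add_card_compl A
  rw [Fintype.card_fin] at hc
  have hLpos : 0 < L := by nlinarith
  rcases le_total (#A) t with hA | hA
  · have h := hu A hA
    generalize #Aᶜ = d at *
    have hsL : s * L ≤ a * t := by
      zify at *
      have h1 : (a : ℤ) = b * s + 1 - t := by linarith
      have h2 : (L : ℤ) = b * t + 1 - t := by linarith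
      rw [h1, h2]
      nlinarith [mul_nonneg (sub_nonneg.2 hts) (sub_nonneg.2 (Int.add_one_le_iff.2 ht))]
    have hrm : r ≤ m := by
      have h0 : 0 < s * L := Nat.mul_pos (by omega) hLpos
      exact Nat.le_of_mul_le_mul_right ((Nat.mul_le_mul_left r hsL).trans hmr) h0
    rcases le_total a (b * d) with had | had
    · calc r * a ≤ r * (b * d) := Nat.mul_le_mul_left _ had
        _ = r * b * d := by ring
        _ ≤ _ := Nat.le_add_left _ _
    · obtain ⟨x, rfl⟩ := Nat.exists_eq_add_of_le had
      have := Nat.mul_le_mul_right x hrm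
      linarith
  · have h := card_mul_le_mul_sum ht (le_sum_of_card_eq hat hL hu) A hA
    generalize #Aᶜ = d at *
    generalize #A = k at *
    generalize ∑ i ∈ A, u i = S at *
    have hs : 0 < s * t := Nat.mul_pos (by omega) ht
    refine Nat.le_of_mul_le_mul_left (c := s * t) ?_ hs
    have h1 : s * a ≤ k * a + s * (b * d) := by
      zify at *
      have h1 : (a : ℤ) = b * s + 1 - t := by linarith
      have h2 : (d : ℤ) = s - k := by linarith
      have h3 : 0 ≤ (d : ℤ) := by positivity
      rw [h2] at h3
      rw [h1, h2]
      nlinarith [mul_nonneg h3 (sub_nonneg.2 (Int.add_one_le_iff.2 ht))]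
    calc s * t * (r * a) = r * t * (s * a) := by ring
      _ ≤ r * t * (k * a + s * (b * d)) := Nat.mul_le_mul_left _ h1
      _ = k * (r * (a * t)) + s * t * (r * b * d) := by ring
      _ ≤ k * (m * (s * L)) + s * t * (r * b * d) :=
        Nat.add_le_add_right (Nat.mul_le_mul_left _ hmr) _
      _ = s * (k * (m * L)) + s * t * (r * b * d) := by ring
      _ ≤ s * (t * S) + s * t * (r * b * d) := Nat.add_le_add_right (Nat.mul_le_mul_left _ h) _
      _ = _ := by ring

theorem const_mem_symbolicExponents (ht : 0 < t) (hat : a + t = b * s + 1)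
    (hL : L + t = b * t + 1) {m c : ℕ} (hc : m * L ≤ t * c) :
    Finsupp.equivFunOnFinite.symm (fun _ : Fin s => c) ∈ symbolicExponents s a b t m := by
  intro A hA
  have hcard := Finset.card_add_card_compl A
  rw [Fintype.card_fin] at hcard
  simp only [Finsupp.coe_equivFunOnFinite_symm, sum_const, smul_eq_mul]
  generalize #Aᶜ = d at *
  generalize #A = k at *
  refine Nat.le_of_mul_le_mul_left (c := t) ?_ ht
  -- The difference of the two sides is (t - k)(t - 1).
  have h1 : t * a ≤ k * L + t * (b * d) := by
    zify at *
    have h1 : (a : ℤ) = b * s + 1 - t := by linarith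
    have h2 : (L : ℤ) = b * t + 1 - t := by linarith
    have h3 : (d : ℤ) = s - k := by linarith
    rw [h1, h2, h3]
    nlinarith [mul_nonneg (sub_nonneg.2 hA) (sub_nonneg.2 (Int.add_one_le_iff.2 ht))]
  calc t * (m * a) = m * (t * a) := by ring
    _ ≤ m * (k * L + t * (b * d)) := Nat.mul_le_mul_left _ h1
    _ = k * (m * L) + t * (m * b * d) := by ring
    _ ≤ k * (t * c) + t * (m * b * d) := Nat.add_le_add_right (Nat.mul_le_mul_left _ hc) _
    _ = _ := by ring

end Exponents

/-! ### Waldschmidt constant and resurgence -/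

section InitialDegree

variable {K : Type*} [Field K] {s : ℕ}

theorem initialDegree_le_of_monomial_mem {J : Ideal (MvPolynomial (Fin s) K)} {u : Fin s →₀ ℕ}
    (hu : monomial u (1 : K) ∈ J) : initialDegree J ≤ ∑ i, u i :=
  Nat.sInf_le ⟨_, hu, by simp, isHomogeneous_monomial _ (Finsupp.degree_eq_sum u)⟩

theorem le_initialDegree {J : Ideal (MvPolynomial (Fin s) K)} {u : Fin s →₀ ℕ}
    (hu : monomial u (1 : K) ∈ J) {n : ℕ} (h : ∀ f ∈ J, ∀ v ∈ f.support, n ≤ ∑ i, v i) :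
    n ≤ initialDegree J := by
  refine le_csInf
    ⟨_, _, hu, by simp, isHomogeneous_monomial _ (Finsupp.degree_eq_sum u)⟩ ?_
  rintro d ⟨f, hf, hf0, hd⟩
  obtain ⟨v, hv⟩ := Finset.nonempty_iff_ne_empty.2 (mt support_eq_empty.1 hf0)
  refine (h f hf v hv).trans_eq ?_
  rw [← Finsupp.degree_eq_sum]
  by_contra hne
  exact mem_support_iff.1 hv (hd.coeff_eq_zero hne)

theorem monomial_mem_iff {J : Ideal (MvPolynomial (Fin s) K)} {E : Set (Fin s →₀ ℕ)}
    (hJ : ∀ f, f ∈ J ↔ ∀ u ∈ f.support, u ∈ E) {u : Fin s →₀ ℕ} :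
    monomial u (1 : K) ∈ J ↔ u ∈ E := by
  classical
  rw [hJ, support_monomial, if_neg one_ne_zero]
  simp

theorem initialDegree_veroneseIdeal {a b : ℕ} (has : a ≤ b * s) :
    initialDegree (veroneseIdeal K s a b) = a := by
  obtain ⟨n, -, hn, hna⟩ := exists_between_sum_eq (σ := Fin s) (l := 0) (h := fun _ => b)
    (fun _ => Nat.zero_le _) (by simp)
    (by simpa [mul_comm] using has)
  have hmem : monomial (Finsupp.equivFunOnFinite.symm n) (1 : K) ∈ veroneseIdeal K s a b := by
    rw [monomial_mem_iff (E := {u | a ≤ ∑ i, min (u i) b}) fun _ => mem_veroneseIdeal_iff]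
    simp only [Set.mem_ofPred_eq, Finsupp.coe_equivFunOnFinite_symm]
    rw [← hna]
    exact Finset.sum_le_sum fun i _ => le_min le_rfl (hn i)
  refine le_antisymm ?_ ?_
  · simpa [hna] using initialDegree_le_of_monomial_mem hmem
  · exact le_initialDegree hmem fun f hf v hv => (mem_veroneseIdeal_iff.1 hf v hv).trans
      (Finset.sum_le_sum fun i _ => min_le_left _ _)

variable {a b t L : ℕ}

theorem const_monomial_mem_symbolicPower (hb : 0 < b) (ht : 0 < t) (hts : t ≤ s)
    (hat : a + t = b * s + 1) (hL : L + t = b * t + 1) {m c : ℕ} (hc : m * L ≤ t * c) :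
    monomial (Finsupp.equivFunOnFinite.symm fun _ : Fin s => c) (1 : K) ∈
      symbolicPower (veroneseIdeal K s a b) m :=
  (monomial_mem_iff fun _ => mem_symbolicPower_veroneseIdeal_iff hb hat hts).2
    (const_mem_symbolicExponents ht hat hL hc)

theorem tendsto_initialDegree_symbolicPower (hb : 0 < b) (ht : 0 < t) (hts : t ≤ s)
    (hat : a + t = b * s + 1) (hL : L + t = b * t + 1) :
    Filter.Tendsto
      (fun m : ℕ => (initialDegree (symbolicPower (veroneseIdeal K s a b) m) : ℝ) / (m : ℝ))
      Filter.atTop (nhds ((s : ℝ) * L / t)) := by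
  have ht' : (0 : ℝ) < t := by exact_mod_cast ht
  have hup : Filter.Tendsto (fun m : ℕ => (s : ℝ) * L / t + s / (m : ℝ)) Filter.atTop
      (nhds ((s : ℝ) * L / t)) := by
    simpa using tendsto_const_nhds.add (tendsto_const_div_atTop_nhds_zero_nat (s : ℝ))
  refine tendsto_of_tendsto_of_tendsto_of_le_of_le' tendsto_const_nhds hup ?_ ?_
  · filter_upwards [Filter.eventually_gt_atTop 0] with m hm
    have hm' : (0 : ℝ) < m := by exact_mod_cast hm
    -- Any monomial in the ideal serves here: it rules out the default value 0 of `sInf ∅`.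
    have hmem := const_monomial_mem_symbolicPower (K := K) hb ht hts hat hL (m := m) (c := m * L)
      (Nat.le_mul_of_pos_left _ ht)
    have h : (s * (m * L) + t - 1) / t ≤
        initialDegree (symbolicPower (veroneseIdeal K s a b) m) :=
      le_initialDegree hmem fun f hf v hv => by
        have := mul_le_mul_degree ht hts hat hL
          ((mem_symbolicPower_veroneseIdeal_iff hb hat hts).1 hf v hv)
        refine Nat.le_of_lt_succ ((Nat.div_lt_iff_lt_mul ht).2 ?_)
        rw [Nat.succ_mul, mul_comm _ t]
        omega
    have h2 : s * (m * L) ≤ t * initialDegree (symbolicPower (veroneseIdeal K s a b) m) := by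
      have h3 := (Nat.div_lt_iff_lt_mul ht).1 (Nat.lt_succ_of_le h)
      rw [Nat.succ_mul, mul_comm _ t] at h3
      omega
    rw [div_le_div_iff₀ ht' hm']
    have h3 : (s : ℝ) * (m * L) ≤
        t * initialDegree (symbolicPower (veroneseIdeal K s a b) m) := by exact_mod_cast h2
    linarith
  · filter_upwards [Filter.eventually_gt_atTop 0] with m hm
    have hm' : (0 : ℝ) < m := by exact_mod_cast hm
    have hdiv : t * (m * L / t) ≤ m * L := Nat.mul_div_le _ _
    have hmem := const_monomial_mem_symbolicPower (K := K) hb ht hts hat hL (m := m)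
      (c := m * L / t + 1) (Nat.lt_mul_div_succ _ ht).le
    have h := initialDegree_le_of_monomial_mem hmem
    simp only [Finsupp.coe_equivFunOnFinite_symm, sum_const, card_univ, Fintype.card_fin,
      smul_eq_mul] at h
    have h2 : t * initialDegree (symbolicPower (veroneseIdeal K s a b) m) ≤
        s * (m * L) + s * t :=
      calc _ ≤ t * (s * (m * L / t + 1)) := Nat.mul_le_mul_left _ h
        _ = s * (t * (m * L / t)) + s * t := by ring
        _ ≤ _ := Nat.add_le_add_right (Nat.mul_le_mul_left _ hdiv) _
    have h3 : (t : ℝ) * initialDegree (symbolicPower (veroneseIdeal K s a b) m) ≤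
        s * (m * L) + s * t := by exact_mod_cast h2
    rw [div_add_div _ _ ht'.ne' hm'.ne', div_le_div_iff₀ hm' (by positivity)]
    nlinarith

theorem isLUB_noncontainmentRatios (hb : 0 < b) (ht : 0 < t) (hts : t ≤ s)
    (hat : a + t = b * s + 1) (hL : L + t = b * t + 1) (ha : 0 < a) :
    (noncontainmentRatios (veroneseIdeal K s a b)).Nonempty ∧
    IsLUB (noncontainmentRatios (veroneseIdeal K s a b)) ((a : ℝ) * t / (s * L)) := by
  have hLpos : 0 < L := by nlinarith
  have hsL : (0 : ℝ) < s * L := by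
    have : 0 < s * L := Nat.mul_pos (by omega) hLpos
    exact_mod_cast this
  have hmem : ∀ N : ℕ, 0 < N → ((t * a * N : ℕ) : ℝ) / ((s * N * L + 1 : ℕ) : ℝ) ∈
      noncontainmentRatios (veroneseIdeal K s a b) := fun N hN => by
    -- The constant vector c = aNL satisfies m L = t c exactly, and its degree saNL falls just short
    -- of r a.
    refine ⟨t * a * N, s * N * L + 1, by positivity, Nat.succ_pos _, fun hle => ?_, rfl⟩
    have h1 := hle (const_monomial_mem_symbolicPower (K := K) hb ht hts hat hL
      (m := t * a * N) (c := a * N * L) (by rw [mul_assoc, mul_assoc, mul_assoc]))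
    rw [monomial_mem_iff fun _ => mem_foldProductIdeal_pow_iff] at h1
    have h2 := (show (s * N * L + 1) * a ≤ _ from h1).trans
      (Finset.sum_le_sum fun i _ => min_le_left _ _)
    simp only [Finsupp.coe_equivFunOnFinite_symm, sum_const, card_univ, Fintype.card_fin,
      smul_eq_mul] at h2
    linarith
  refine ⟨⟨_, hmem 1 one_pos⟩, ?_, ?_⟩
  · rintro _ ⟨m, r, hm, hr, hmr, rfl⟩
    have hr' : (0 : ℝ) < r := by exact_mod_cast hr
    by_contra! hlt
    rw [div_lt_div_iff₀ hsL hr'] at hlt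
    have hlt' : r * (a * t) ≤ m * (s * L) := by
      have : a * t * r < m * (s * L) := by exact_mod_cast hlt
      linarith
    refine hmr fun f hf => mem_foldProductIdeal_pow_iff.2 fun u hu => ?_
    exact mem_powerExponents_of_mem_symbolicExponents hb ht hts hat hL hlt'
      ((mem_symbolicPower_veroneseIdeal_iff hb hat hts).1 hf u hu)
  · intro B hB
    rw [div_le_iff₀ hsL]
    by_contra! hlt
    obtain ⟨N, hN⟩ := exists_nat_gt (B / ((a : ℝ) * t - B * (s * L)))
    rw [div_lt_iff₀ (sub_pos.2 hlt)] at hN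
    have h0 := hB (hmem (N + 1) (Nat.succ_pos _))
    rw [div_le_iff₀ (by positivity)] at h0
    push_cast at h0
    linarith

end InitialDegree

end FoldProduct

/-- The supremum and the limit that define the resurgence and the Waldschmidt constant are part of
the conclusion. The division in `hc₀` is floor division of integers (by `b > 0`). -/
theorem mainTheorem6 {K : Type*} [Field K] (a b s : ℕ) (hb : 0 < b)
    (ha : (b - 1) * s + 1 < a) (has : a ≤ b * s)
    (δ c₀ μ₀ : ℤ) (hδ : δ = (a : ℤ) - ((b : ℤ) - 1) * (s : ℤ) - 1)
    (hc₀ : c₀ = (s : ℤ) - ((a : ℤ) - 1) / (b : ℤ))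
    (hμ₀ : μ₀ = (a : ℤ) - (b : ℤ) * ((s : ℤ) - c₀))
    (I : Ideal (MvPolynomial (Fin s) K))
    (hI : I = FoldProduct.foldProductIdeal a
      (fun i : Fin s => (MvPolynomial.X i : MvPolynomial (Fin s) K)) (fun _ => b)) :
    IsLUB (FoldProduct.noncontainmentRatios I) (FoldProduct.resurgence I) ∧
    Filter.Tendsto
      (fun m : ℕ => (FoldProduct.initialDegree (FoldProduct.symbolicPower I m) : ℝ) / (m : ℝ))
      Filter.atTop (nhds (FoldProduct.waldschmidtConstant I)) ∧
    0 < FoldProduct.waldschmidtConstant I ∧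
    FoldProduct.resurgence I
      = (FoldProduct.initialDegree I : ℝ) / FoldProduct.waldschmidtConstant I ∧
    (FoldProduct.initialDegree I : ℝ) / FoldProduct.waldschmidtConstant I
      = ((a : ℝ) * ((s : ℝ) - (δ : ℝ))) /
        ((s : ℝ) * ((μ₀ : ℝ) + (b : ℝ) * ((s : ℝ) - (δ : ℝ) - (c₀ : ℝ)))) := by
  subst hI
  obtain ⟨b, rfl⟩ : ∃ b', b = b' + 1 := ⟨b - 1, by omega⟩
  rw [Nat.add_sub_cancel] at ha
  obtain ⟨t, hat⟩ : ∃ t, a + t = (b + 1) * s + 1 := ⟨(b + 1) * s + 1 - a, by omega⟩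
  have ht : 0 < t := by omega
  have hts : t ≤ s := by linarith
  have hL : (b * t + 1) + t = (b + 1) * t + 1 := by ring
  have hlim := FoldProduct.tendsto_initialDegree_symbolicPower (K := K) hb ht hts hat hL
  obtain ⟨hne, hlub⟩ :=
    FoldProduct.isLUB_noncontainmentRatios (K := K) hb ht hts hat hL (by omega)
  have hW : FoldProduct.waldschmidtConstant (FoldProduct.veroneseIdeal K s a (b + 1)) =
      (s : ℝ) * (b * t + 1 : ℕ) / t := hlim.limUnder_eq
  have hR : FoldProduct.resurgence (FoldProduct.veroneseIdeal K s a (b + 1)) =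
      (a : ℝ) * t / (s * (b * t + 1 : ℕ)) := hlub.csSup_eq hne
  have ht' : (0 : ℝ) < t := by exact_mod_cast ht
  have hs' : (0 : ℝ) < s := by exact_mod_cast ht.trans_le hts
  have hδt : (s : ℝ) - (δ : ℝ) = t := by
    have : (s : ℤ) - δ = t := by
      zify at hat
      rw [hδ]
      push_cast
      linarith
    exact_mod_cast this
  -- The c₀ terms cancel, leaving a - (b + 1)(s - t) = bt + 1, which is L.
  have hμL : (μ₀ : ℝ) + ((b + 1 : ℕ) : ℝ) * ((s : ℝ) - (δ : ℝ) - (c₀ : ℝ)) =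
      (b * t + 1 : ℕ) := by
    rw [hδt, hμ₀]
    have hat' : (a : ℝ) + t = (b + 1) * s + 1 := by exact_mod_cast hat
    push_cast
    linarith
  rw [hW, hR, FoldProduct.initialDegree_veroneseIdeal has, hμL, hδt]
  refine ⟨hlub, hlim, by positivity, ?_, ?_⟩ <;> rw [div_div_eq_mul_div]
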